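/- Let $\Sigma$ be the linear system $\dot x(t)=Ax(t)+Bu(t)$, $x(0)=x_0$, $y(t)=Cx(t)+Du(t)$ with $u(t)\in\mathbb R^m$, $x(t)\in\mathbb R^n$, $y(t)\in\mathbb R^p$ and real matrices $A,B,C,D$. Let $\mathcal U\subseteq\mathbb R^m$ and $\mathcal X\subseteq\mathbb R^n$ be arbitrary sets, and let $\mathfrak S$ denote the system $\Sigma$ subject to the constraints $u(t)\in\mathcal U$ and $x(t)\in\mathcal X$ for all $t\ge 0$. Inputs are causal, piecewise continuous (with finite one-sided limits) and exponentially bounded; states are continuous and outputs piecewise continuous on $[0,\infty)$; two signals are regarded as equal if they agree at almost every time $t\ge 0$. A pair $(x_0,y)$, with $x_0\in\mathcal X$ and $y$ a piecewise continuous output signal, is admissible if some input $u$ with $u(t)\in\mathcal U$ for all $t\ge0$ produces the output $y$ from the initial state $x_0$ along a state trajectory with $x(t)\in\mathcal X$ for all $t\ge 0$; it is input redundant if at least two distinct such inputs exist. Let $\mathbf A$ and $\mathbf S\subseteq\mathbf A$ be the sets of admissible and of input redundant pairs of $\mathfrak S$. The system $\mathfrak S$ is input redundant if $\mathbf S\neq\varnothing$,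 and uniformly input redundant if $\mathbf A=\mathbf S\neq\varnothing$; input redundancy of $\Sigma$ is the same notion with $\mathcal U=\mathbb R^m$ and $\mathcal X=\mathbb R^n$. Put $\rho=\dim(\ker B\cap\ker D)$. Assume that the unconstrained system $\Sigma$ is input redundant and that one of the following holds: - $\rho>0$ and $\mathcal U$ is open; - $\rho=0$ and both $\mathcal U$ and $\mathcal X$ are open. Then every admissible pair of $\mathfrak S$ is input redundant, i.e. $\mathbf S=\mathbf A$. Consequently, if $\mathfrak S$ has at least one admissible pair, then $\mathfrak S$ is uniformly input redundant, i.e. $\mathbf S=\mathbf A\neq\varnothing$. -/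

import Mathlib

open MeasureTheory Set Filter Topology
open scoped Matrix

namespace InputRedundancy

/- Vectors of `ℝ^k` are functions `Fin k → ℝ`; only their topology matters (the norm is used in
exponential bounds only, where all norms are equivalent). A signal on `ℝ≥0` is represented by a
function on `ℝ` of which only the values at times `t ≥ 0` are ever used. -/

/-- The matrices of the linear system `x' = A x + B u`, `y = C x + D u`. -/
structure LTISystem (n m p : ℕ) where
  A : Matrix (Fin n) (Fin n) ℝ
  B : Matrix (Fin n) (Fin m) ℝ
  C : Matrix (Fin p) (Fin n) ℝ
  D : Matrix (Fin p) (Fin m) ℝ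

/-- Equality of signals on `ℝ≥0`: they agree at almost every time. -/
def SignalEq {k : ℕ} (f g : ℝ → Fin k → ℝ) : Prop :=
  ∀ᵐ t ∂(volume.restrict (Ici (0 : ℝ))), f t = g t

/-- Piecewise continuity on `[0, ∞)`: finitely many discontinuities on each `[0, T]`, and finite
one-sided limits everywhere. -/
def IsPiecewiseContinuous {k : ℕ} (f : ℝ → Fin k → ℝ) : Prop :=
  (∀ T : ℝ, {t : ℝ | t ∈ Icc 0 T ∧ ¬ ContinuousWithinAt f (Ici 0) t}.Finite) ∧
  (∀ t : ℝ, 0 ≤ t → ∃ l : Fin k → ℝ, Tendsto f (𝓝[>] t) (𝓝 l)) ∧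
  (∀ t : ℝ, 0 < t → ∃ l : Fin k → ℝ, Tendsto f (𝓝[<] t) (𝓝 l))

/-- Unconstrained inputs: causal, piecewise continuous, exponentially bounded signals. -/
def InputSignals (m : ℕ) : Set (ℝ → Fin m → ℝ) :=
  {u | (∀ t : ℝ, t < 0 → u t = 0) ∧ IsPiecewiseContinuous u ∧
    ∃ M a : ℝ, ∀ t : ℝ, 0 ≤ t → ‖u t‖ ≤ M * Real.exp (a * t)}

/-- Unconstrained state trajectories: continuous functions on `[0, ∞)`. -/
def StateSignals (n : ℕ) : Set (ℝ → Fin n → ℝ) :=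
  {x | ContinuousOn x (Ici 0)}

/-- Outputs: piecewise continuous functions on `[0, ∞)`. -/
def OutputSignals (p : ℕ) : Set (ℝ → Fin p → ℝ) :=
  {y | IsPiecewiseContinuous y}

/-- Inputs complying with the input constraint set `U`. -/
def ConstrainedInputs {m : ℕ} (U : Set (Fin m → ℝ)) : Set (ℝ → Fin m → ℝ) :=
  {u | ∀ t : ℝ, 0 ≤ t → u t ∈ U} ∩ InputSignals m

/-- State trajectories complying with the state constraint set `X`. -/
def ConstrainedStates {n : ℕ} (X : Set (Fin n → ℝ)) : Set (ℝ → Fin n → ℝ) :=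
  {x | ∀ t : ℝ, 0 ≤ t → x t ∈ X} ∩ StateSignals n

namespace LTISystem

variable {n m p : ℕ}

/-- `ρ = dim (ker B ∩ ker D)`. -/
noncomputable def rho (S : LTISystem n m p) : ℕ :=
  Module.finrank ℝ
    (LinearMap.ker S.B.mulVecLin ⊓ LinearMap.ker S.D.mulVecLin : Submodule ℝ (Fin m → ℝ))

/-- `x` is the state trajectory produced by the input `u` from `x0`: it solves `x' = A x + B u`,
`x 0 = x0`, in integral form (as `u` is only piecewise continuous). -/
def IsStateResponse (S : LTISystem n m p) (x0 : Fin n → ℝ)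
    (u : ℝ → Fin m → ℝ) (x : ℝ → Fin n → ℝ) : Prop :=
  ∀ t : ℝ, 0 ≤ t → x t = x0 + ∫ s in (0 : ℝ)..t, (S.A *ᵥ x s + S.B *ᵥ u s)

/-- Input-state-output triples of the unconstrained system compatible for `x0`. -/
def unconstrainedTriples (S : LTISystem n m p) (x0 : Fin n → ℝ) :
    Set ((ℝ → Fin m → ℝ) × (ℝ → Fin n → ℝ) × (ℝ → Fin p → ℝ)) :=
  {q | q ∈ InputSignals m ×ˢ StateSignals n ×ˢ OutputSignals p ∧
    S.IsStateResponse x0 q.1 q.2.1 ∧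
    SignalEq q.2.2 (fun t => S.C *ᵥ q.2.1 t + S.D *ᵥ q.1 t)}

/-- Input-state-output triples of the constrained system compatible for `x0`. -/
def triples (S : LTISystem n m p) (U : Set (Fin m → ℝ)) (X : Set (Fin n → ℝ))
    (x0 : Fin n → ℝ) : Set ((ℝ → Fin m → ℝ) × (ℝ → Fin n → ℝ) × (ℝ → Fin p → ℝ)) :=
  S.unconstrainedTriples x0 ∩ (ConstrainedInputs U ×ˢ ConstrainedStates X ×ˢ OutputSignals p)

/-- Input-output pairs of the constrained system compatible for `x0`. -/
def ioPairs (S : LTISystem n m p) (U : Set (Fin m → ℝ)) (X : Set (Fin n → ℝ))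
    (x0 : Fin n → ℝ) : Set ((ℝ → Fin m → ℝ) × (ℝ → Fin p → ℝ)) :=
  {w | ∃ x : ℝ → Fin n → ℝ, (w.1, x, w.2) ∈ S.triples U X x0}

/-- Admissible pairs `(x0, y)` of the constrained system. -/
def admissiblePairs (S : LTISystem n m p) (U : Set (Fin m → ℝ)) (X : Set (Fin n → ℝ)) :
    Set ((Fin n → ℝ) × (ℝ → Fin p → ℝ)) :=
  {a | a ∈ X ×ˢ OutputSignals p ∧ ∃ u : ℝ → Fin m → ℝ, (u, a.2) ∈ S.ioPairs U X a.1}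

/-- Input redundant pairs `(x0, y)` of the constrained system: two distinct inputs produce `y`
from `x0`. -/
def irPairs (S : LTISystem n m p) (U : Set (Fin m → ℝ)) (X : Set (Fin n → ℝ)) :
    Set ((Fin n → ℝ) × (ℝ → Fin p → ℝ)) :=
  {a | a ∈ X ×ˢ OutputSignals p ∧
    ∃ w₁ ∈ S.ioPairs U X a.1, ∃ w₂ ∈ S.ioPairs U X a.1,
      ¬ SignalEq w₁.1 w₂.1 ∧ SignalEq w₁.2 a.2 ∧ SignalEq w₂.2 a.2}

/-- The constrained system is input redundant. -/
def IsIR (S : LTISystem n m p) (U : Set (Fin m → ℝ)) (X : Set (Fin n → ℝ)) : Prop :=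
  (S.irPairs U X).Nonempty

/-- The unconstrained system is input redundant. -/
def IsUnconstrainedIR (S : LTISystem n m p) : Prop :=
  S.IsIR univ univ

/-- The constrained system is uniformly input redundant: it is input redundant and every
admissible pair is input redundant. -/
def IsUniformlyIR (S : LTISystem n m p) (U : Set (Fin m → ℝ)) (X : Set (Fin n → ℝ)) : Prop :=
  S.IsIR U X ∧ S.admissiblePairs U X = S.irPairs U X

end LTISystem

end InputRedundancy

/-! Redundancy is local in time. It suffices to find, on every interval `[a, b]` with `0 ≤ a < b`, a
nonzero continuous input that steers `0` to `0` with zero output, input and state both vanishing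
outside `[a, b]`. Placed next to a time where the given input is continuous and scaled down, it can
be added without leaving the open constraint sets (`admissiblePairs_subset_irPairs`). If `ρ > 0`, a
bump times a vector of `ker B ∩ ker D` works and leaves the state unchanged, so `X` need not be
open.

Otherwise two inputs with the same output are turned into such a perturbation algebraically.
Continuous causal functions form a module over `ℝ[X]`, with `X` acting as integration from `0`. The
state difference and the integrated input difference satisfy linear relations over `ℝ[X]`. The
module is torsion-free (`eq_zero_of_smul_eq_zero`), so the finitely generated submodule spanned by
these signals is free, and a linear functional sends the relations to polynomials while keeping the
input part nonzero (`exists_polynomial_kernel`). Applying these polynomials to a high derivative of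
a bump function gives signals supported in `[a, b]`, and torsion-freeness keeps the input nonzero.
-/

namespace InputRedundancy

open Polynomial

/-! ### Causal functions as a module over polynomials in the integration operator -/

/-- Continuous real functions that vanish on `(-∞, 0]`. -/
def causalFunctions : Submodule ℝ (ℝ → ℝ) where
  carrier := {f | Continuous f ∧ ∀ t ≤ 0, f t = 0}
  add_mem' := fun hf hg => ⟨hf.1.add hg.1, fun t ht => by simp [hf.2 t ht, hg.2 t ht]⟩
  zero_mem' := ⟨continuous_const, fun _ _ => rfl⟩
  smul_mem' := fun c _ hf => ⟨hf.1.const_smul c, fun t ht => by simp [hf.2 t ht]⟩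

/-- Integration from `0` on `causalFunctions`. -/
noncomputable def integration : causalFunctions →ₗ[ℝ] causalFunctions where
  toFun f := ⟨fun t => ∫ s in (0 : ℝ)..t, f.1 s,
    intervalIntegral.continuous_primitive (fun a b => f.2.1.intervalIntegrable a b) 0,
    fun t ht => by
      change ∫ s in (0 : ℝ)..t, f.1 s = 0
      rw [intervalIntegral.integral_congr (g := fun _ => (0 : ℝ)), intervalIntegral.integral_zero]
      intro s hs
      rw [uIcc_of_ge ht] at hs
      exact f.2.2 s hs.2⟩
  map_add' f g := by
    ext t
    exact intervalIntegral.integral_add (f.2.1.intervalIntegrable 0 t)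
      (g.2.1.intervalIntegrable 0 t)
  map_smul' c f := by
    ext t
    exact intervalIntegral.integral_const_mul c f.1

/-- `causalFunctions` as a module over `ℝ[X]`, with `X` acting as integration from `0`. -/
abbrev CausalModule : Type := Module.AEval' integration

namespace CausalModule

/-- The function underlying an element of `CausalModule`. -/
noncomputable def eval : CausalModule →ₗ[ℝ] (ℝ → ℝ) :=
  causalFunctions.subtype ∘ₗ (Module.AEval'.of integration).symm.toLinearMap

/-- The element of `CausalModule` given by a continuous function vanishing on `(-∞, 0]`. -/
noncomputable def mk (f : ℝ → ℝ) (hf : Continuous f) (hf0 : ∀ t ≤ 0, f t = 0) : CausalModule :=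
  Module.AEval'.of integration ⟨f, hf, hf0⟩

@[simp] lemma eval_mk (f : ℝ → ℝ) (hf : Continuous f) (hf0 : ∀ t ≤ 0, f t = 0) :
    eval (mk f hf hf0) = f := rfl

lemma eval_injective : Function.Injective eval :=
  Subtype.val_injective.comp (Module.AEval'.of integration).symm.injective

lemma continuous_eval (f : CausalModule) : Continuous (eval f) :=
  ((Module.AEval'.of integration).symm f).2.1

lemma eval_of_nonpos (f : CausalModule) {t : ℝ} (ht : t ≤ 0) : eval f t = 0 :=
  ((Module.AEval'.of integration).symm f).2.2 t ht

lemma eval_X_smul (f : CausalModule) (t : ℝ) :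
    eval ((X : ℝ[X]) • f) t = ∫ s in (0 : ℝ)..t, eval f s := by
  have := Module.AEval'.X_smul_of integration ((Module.AEval'.of integration).symm f)
  rw [LinearEquiv.apply_symm_apply] at this
  rw [this]
  rfl

@[simp] lemma eval_C_smul (c : ℝ) (f : CausalModule) :
    eval ((C c : ℝ[X]) • f) = c • eval f := by
  rw [Module.AEval.C_smul, map_smul]

lemma hasDerivAt_eval_X_smul (f : CausalModule) (t : ℝ) :
    HasDerivAt (eval ((X : ℝ[X]) • f)) (eval f t) t := by
  rw [show eval ((X : ℝ[X]) • f) = fun t => ∫ s in (0 : ℝ)..t, eval f s from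
    funext (eval_X_smul f)]
  exact (continuous_eval f).integral_hasStrictDerivAt 0 t |>.hasDerivAt

lemma X_smul_injective : Function.Injective fun f : CausalModule => (X : ℝ[X]) • f := by
  intro f g hfg
  apply eval_injective
  funext t
  have h := hasDerivAt_eval_X_smul f t
  rw [show (X : ℝ[X]) • f = (X : ℝ[X]) • g from hfg] at h
  exact h.unique (hasDerivAt_eval_X_smul g t)

/-- In the sup norm weighted by `exp (-l t)`, integration has norm at most `1 / l`, which is small
for large `l`. -/
lemma abs_eval_X_smul_le {f : CausalModule} {T M l : ℝ} (hl : 0 < l)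
    (hf : ∀ t ∈ Icc 0 T, |eval f t| ≤ M * Real.exp (l * t)) (hM : 0 ≤ M) :
    ∀ t ∈ Icc 0 T, |eval ((X : ℝ[X]) • f) t| ≤ M / l * Real.exp (l * t) := by
  intro t ht
  rw [eval_X_smul]
  have hd : ∀ s : ℝ, HasDerivAt (fun s => M / l * Real.exp (l * s)) (M * Real.exp (l * s)) s := by
    intro s
    have h1 : HasDerivAt (fun s : ℝ => l * s) l s := by simpa using (hasDerivAt_id s).const_mul l
    have := h1.exp.const_mul (M / l)
    rwa [mul_left_comm, div_mul_cancel₀ _ hl.ne', mul_comm (Real.exp _)] at this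
  have hc : Continuous fun s : ℝ => M * Real.exp (l * s) := by fun_prop
  have hint := intervalIntegral.integral_eq_sub_of_hasDerivAt (a := 0) (b := t)
    (fun s _ => hd s) (hc.intervalIntegrable 0 t)
  have hle := intervalIntegral.norm_integral_le_of_norm_le (μ := volume) (f := eval f) ht.1
    (Eventually.of_forall fun s hs => hf s ⟨hs.1.le, hs.2.trans ht.2⟩)
    (hc.intervalIntegrable 0 t)
  rw [hint] at hle
  have : 0 ≤ M / l * Real.exp (l * 0) := by positivity
  rw [Real.norm_eq_abs] at hle
  linarith

/-- The point is the order of quantifiers: `K` depends on `q` alone, so the weight `l` may be chosen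
afterwards in terms of `K`. -/
lemma exists_abs_eval_smul_le (q : ℝ[X]) : ∃ K : ℝ, 0 ≤ K ∧ ∀ (f : CausalModule) (T M l : ℝ),
    1 ≤ l → 0 ≤ M → (∀ t ∈ Icc 0 T, |eval f t| ≤ M * Real.exp (l * t)) →
      ∀ t ∈ Icc 0 T, |eval (q • f) t| ≤ K * M * Real.exp (l * t) := by
  induction q using Polynomial.induction_on' with
  | add p q hp hq =>
    obtain ⟨K, hK, hp⟩ := hp
    obtain ⟨L, hL, hq⟩ := hq
    refine ⟨K + L, by positivity, fun f T M l hl hM hf t ht => ?_⟩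
    rw [add_smul, map_add, Pi.add_apply]
    have h1 := hp f T M l hl hM hf t ht
    have h2 := hq f T M l hl hM hf t ht
    calc _ ≤ _ := abs_add_le _ _
      _ ≤ _ := add_le_add h1 h2
      _ = _ := by ring
  | monomial k c =>
    refine ⟨|c|, abs_nonneg c, fun f T M l hl hM hf => ?_⟩
    have key : ∀ t ∈ Icc 0 T, |eval ((X ^ k : ℝ[X]) • f) t| ≤ M * Real.exp (l * t) := by
      induction k with
      | zero => simpa using hf
      | succ k ih =>
        intro t ht
        rw [pow_succ', mul_smul]
        refine (abs_eval_X_smul_le (by linarith) ih hM t ht).trans ?_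
        gcongr
        exact div_le_self hM hl
    intro t ht
    rw [← C_mul_X_pow_eq_monomial, mul_smul, eval_C_smul, Pi.smul_apply, smul_eq_mul, abs_mul,
      mul_assoc]
    exact mul_le_mul_of_nonneg_left (key t ht) (abs_nonneg c)

/-- A Volterra argument: for a large weight `X * q` is a contraction on each `[0, T]`, so its fixed
point is `0`. -/
lemma eq_zero_of_eq_X_mul_smul {q : ℝ[X]} {f : CausalModule} (h : f = (X * q) • f) : f = 0 := by
  obtain ⟨K, hK, hq⟩ := exists_abs_eval_smul_le q
  apply eval_injective
  funext T
  rw [map_zero, Pi.zero_apply]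
  rcases le_or_gt T 0 with hT | hT
  · exact eval_of_nonpos f hT
  obtain ⟨M, hM⟩ := isCompact_Icc.exists_bound_of_continuousOn (s := Icc 0 T)
    (continuous_eval f).continuousOn
  have hM0 : 0 ≤ M := (norm_nonneg _).trans (hM 0 ⟨le_rfl, hT.le⟩)
  -- With `l = 2 * K + 1` the contraction factor `K / l` is at most `1 / 2`.
  have hl : (1 : ℝ) ≤ 2 * K + 1 := by linarith
  have key : ∀ N : ℕ, ∀ t ∈ Icc 0 T,
      |eval f t| ≤ M * (1 / 2) ^ N * Real.exp ((2 * K + 1) * t) := by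
    intro N
    induction N with
    | zero =>
      intro t ht
      have h1 : 1 ≤ Real.exp ((2 * K + 1) * t) :=
        Real.one_le_exp (mul_nonneg (by linarith) ht.1)
      have h2 : |eval f t| ≤ M := hM t ht
      rw [pow_zero, mul_one]
      nlinarith
    | succ N ih =>
      intro t ht
      have h1 := hq f T _ _ hl (by positivity) ih
      have h2 := abs_eval_X_smul_le (by linarith) h1 (by positivity) t ht
      rw [← mul_smul, ← h] at h2
      refine h2.trans ?_
      gcongr
      rw [pow_succ, div_le_iff₀ (by linarith)]
      have : 0 ≤ M * (1 / 2 : ℝ) ^ N := by positivity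
      nlinarith
  have hlim : Tendsto (fun N : ℕ => M * (1 / 2 : ℝ) ^ N * Real.exp ((2 * K + 1) * T)) atTop
      (𝓝 (M * 0 * Real.exp ((2 * K + 1) * T))) :=
    ((tendsto_pow_atTop_nhds_zero_of_lt_one (by norm_num) (by norm_num)).const_mul M).mul_const _
  have := ge_of_tendsto' hlim fun N => key N T ⟨hT.le, le_rfl⟩
  simpa using this

/-- Factors `X` cancel because integration is injective. Once the constant term is nonzero, `d` is a
constant times `1 - X * q`, and the contraction argument applies. -/
lemma eq_zero_of_smul_eq_zero (d : ℝ[X]) (hd : d ≠ 0) (f : CausalModule) (h : d • f = 0) :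
    f = 0 := by
  induction hk : d.natDegree using Nat.strong_induction_on generalizing d with
  | _ k ih =>
    rcases eq_or_ne (d.coeff 0) 0 with h0 | h0
    · have hX := X_mul_divX_add d
      rw [h0, map_zero, add_zero] at hX
      have hne : d.divX ≠ 0 := by
        rintro h1
        rw [h1, mul_zero] at hX
        exact hd hX.symm
      refine ih d.divX.natDegree ?_ d.divX hne ?_ rfl
      · rw [← hk]
        conv_rhs => rw [← hX]
        rw [natDegree_X_mul hne]
        exact Nat.lt_succ_self _
      · apply X_smul_injective
        change (X : ℝ[X]) • d.divX • f = (X : ℝ[X]) • (0 : CausalModule)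
        rw [smul_zero, ← mul_smul, hX, h]
    · apply eq_zero_of_eq_X_mul_smul (q := C (-(d.coeff 0)⁻¹) * d.divX)
      have h1 : X * (C (-(d.coeff 0)⁻¹) * d.divX) + C (d.coeff 0)⁻¹ * d = 1 := by
        have h2 : C (d.coeff 0)⁻¹ * C (d.coeff 0) = (1 : ℝ[X]) := by
          rw [← C_mul, inv_mul_cancel₀ h0, C_1]
        have h3 := congrArg (C (d.coeff 0)⁻¹ * ·) (X_mul_divX_add d)
        simp only [mul_add, h2] at h3
        rw [← h3, C_neg]
        ring
      have h4 := congrArg (· • f) h1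
      simp only [add_smul, one_smul] at h4
      rw [mul_smul (C _) d, h, smul_zero, add_zero] at h4
      exact h4.symm

instance : Module.IsTorsionFree ℝ[X] CausalModule :=
  Module.isTorsionFree_iff_smul_eq_zero.2 fun d f h =>
    or_iff_not_imp_left.2 fun hd => eq_zero_of_smul_eq_zero d hd f h

end CausalModule

/-- A linear relation over a principal ideal domain that holds between finitely many elements of a
torsion-free module also holds between scalars, not vanishing where the elements do not. -/
lemma exists_functional_ne_zero {R M ι : Type*} [CommRing R] [IsDomain R] [IsPrincipalIdealRing R]
    [AddCommGroup M] [Module R M] [Module.IsTorsionFree R M] [Finite ι] (v : ι → M) (i : ι)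
    (hi : v i ≠ 0) :
    ∃ l : Submodule.span R (range v) →ₗ[R] R,
      l ⟨v i, Submodule.subset_span (mem_range_self i)⟩ ≠ 0 := by
  -- Finitely generated and torsion-free over a principal ideal domain means free, and functionals
  -- separate the points of a free module.
  have : Module.Finite R (Submodule.span R (range v)) :=
    Module.Finite.span_of_finite R (finite_range v)
  have : Module.Free R (Submodule.span R (range v)) := inferInstance
  by_contra! h
  exact hi (congrArg Subtype.val ((Module.forall_dual_apply_eq_zero_iff R _).1 h))

/-! ### Signals with localized iterated integrals -/

namespace CausalModule

/-- There are nonzero signals whose first `L` iterated integrals vanish outside `[a, b]`. -/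
lemma exists_iterated_integrals_supported {a b : ℝ} (ha : 0 ≤ a) (hab : a < b) (L : ℕ) :
    ∃ f : CausalModule, f ≠ 0 ∧
      ∀ k ≤ L, ∀ t ∉ Icc a b, eval ((X ^ k : ℝ[X]) • f) t = 0 := by
  let φ : ContDiffBump ((a + b) / 2) := ⟨(b - a) / 4, (b - a) / 2, by linarith, by linarith⟩
  have hsmooth : ContDiff ℝ ((⊤ : ℕ∞) : WithTop ℕ∞) (φ : ℝ → ℝ) := φ.contDiff
  have hsupp : ∀ k, tsupport (iteratedDeriv k φ) ⊆ Icc a b := by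
    intro k
    induction k with
    | zero =>
      rw [iteratedDeriv_zero, φ.tsupport_eq, Real.closedBall_eq_Icc]
      apply Icc_subset_Icc <;> simp only [φ] <;> linarith
    | succ k ih =>
      rw [iteratedDeriv_succ]
      exact tsupport_deriv_subset.trans ih
  have hzero : ∀ k, ∀ t ∉ Icc a b, iteratedDeriv k φ t = 0 := fun k t ht =>
    image_eq_zero_of_notMem_tsupport fun h => ht (hsupp k h)
  have hcont : ∀ k, Continuous (iteratedDeriv k φ) := fun k =>
    hsmooth.continuous_iteratedDeriv k (by exact_mod_cast le_top)
  have hzero' : ∀ k, ∀ t ≤ 0, iteratedDeriv k φ t = 0 := by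
    intro k t ht
    rcases ht.lt_or_eq with h | h
    · exact hzero k t fun h' => absurd h'.1 (by linarith)
    -- If `a = 0`, the time `0` lies in `[a, b]`; the value there is found by continuity from the
    -- left.
    · have hcl : IsClosed {s | iteratedDeriv k φ s = 0} :=
        isClosed_eq (hcont k) continuous_const
      have hsub : Iio (0 : ℝ) ⊆ {s | iteratedDeriv k φ s = 0} := fun s hs =>
        hzero k s fun h' => absurd h'.1 (by linarith [mem_Iio.1 hs])
      have := hcl.closure_subset_iff.2 hsub
      rw [closure_Iio] at this
      exact this ht
  let g : ℕ → CausalModule := fun k => mk (iteratedDeriv k φ) (hcont k) (hzero' k)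
  have hstep : ∀ k, (X : ℝ[X]) • g (k + 1) = g k := by
    intro k
    apply eval_injective
    funext t
    rw [eval_X_smul]
    simp only [g, eval_mk]
    rw [intervalIntegral.integral_eq_sub_of_hasDerivAt (f := iteratedDeriv k φ),
      hzero' k 0 le_rfl, sub_zero]
    · intro s _
      rw [iteratedDeriv_succ]
      exact ((hsmooth.differentiable_iteratedDeriv k
        (by exact_mod_cast WithTop.coe_lt_top _)) s).hasDerivAt
    · exact (hcont _).intervalIntegrable _ _
  have hpow : ∀ k j, (X ^ k : ℝ[X]) • g (j + k) = g j := by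
    intro k
    induction k with
    | zero => simp
    | succ k ih =>
      intro j
      rw [pow_succ, mul_smul, ← add_assoc, hstep, ih]
  -- The signal is the `L`-th derivative of the bump, so its `k`-th iterated integral is the
  -- derivative of order `L - k`.
  refine ⟨g L, ?_, ?_⟩
  · intro h0
    have h1 := hpow L 0
    rw [zero_add, h0, smul_zero] at h1
    have h2 := congrFun (congrArg eval h1) ((a + b) / 2)
    simp only [g, eval_mk, iteratedDeriv_zero, map_zero, Pi.zero_apply] at h2
    have h3 := φ.pos_of_mem_ball (Metric.mem_ball_self φ.rOut_pos)
    exact h3.ne h2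
  · intro k hk t ht
    obtain ⟨j, rfl⟩ := Nat.exists_eq_add_of_le' hk
    rw [hpow]
    exact hzero j t ht

lemma eval_smul_eq_zero {f : CausalModule} {s : Set ℝ} {L : ℕ}
    (hf : ∀ k ≤ L, ∀ t ∉ s, eval ((X ^ k : ℝ[X]) • f) t = 0) {q : ℝ[X]} (hq : q.natDegree ≤ L)
    {t : ℝ} (ht : t ∉ s) : eval (q • f) t = 0 := by
  rw [q.as_sum_range_C_mul_X_pow, Finset.sum_smul, map_sum, Finset.sum_apply]
  refine Finset.sum_eq_zero fun k hk => ?_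
  rw [mul_smul, eval_C_smul, Pi.smul_apply, hf k (by grind) t ht, smul_zero]

end CausalModule

/-! ### Matrices and integrals -/

section mulVec

variable {k l : ℕ}

lemma intervalIntegrable_mulVec (R : Matrix (Fin l) (Fin k) ℝ) {f : ℝ → Fin k → ℝ} {a b : ℝ}
    (hf : IntervalIntegrable f volume a b) :
    IntervalIntegrable (fun s => R *ᵥ f s) volume a b :=
  ⟨R.mulVecLin.toContinuousLinearMap.integrable_comp hf.1,
    R.mulVecLin.toContinuousLinearMap.integrable_comp hf.2⟩

lemma integral_mulVec (R : Matrix (Fin l) (Fin k) ℝ) {f : ℝ → Fin k → ℝ} {a b : ℝ}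
    (hf : IntervalIntegrable f volume a b) :
    ∫ s in a..b, R *ᵥ f s = R *ᵥ ∫ s in a..b, f s :=
  R.mulVecLin.toContinuousLinearMap.intervalIntegral_comp_comm hf

lemma integral_pi_apply {f : ℝ → Fin k → ℝ} {a b : ℝ}
    (hf : IntervalIntegrable f volume a b) (i : Fin k) :
    (∫ s in a..b, f s) i = ∫ s in a..b, f s i :=
  ((ContinuousLinearMap.proj (R := ℝ) (φ := fun _ : Fin k => ℝ) i).intervalIntegral_comp_comm
    hf).symm

end mulVec

/-! ### Piecewise continuous signals and small perturbations -/

section signals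

variable {k : ℕ}

lemma locallyIntegrable_of_mem_inputSignals {u : ℝ → Fin k → ℝ} (hu : u ∈ InputSignals k) :
    LocallyIntegrable u := by
  obtain ⟨hu0, hpc, M, a, hb⟩ := hu
  have hneg : IntegrableOn u (Iio 0) :=
    integrableOn_zero.congr_fun (fun t ht => (hu0 t ht).symm) measurableSet_Iio
  have hpos : ∀ T, IntegrableOn u (Icc 0 T) := by
    intro T
    have hfin := hpc.1 T
    set F := {t : ℝ | t ∈ Icc 0 T ∧ ¬ ContinuousWithinAt u (Ici 0) t} with hF
    have hcont : ContinuousOn u (Icc 0 T \ F) := by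
      intro t ht
      have : ContinuousWithinAt u (Ici 0) t := by
        by_contra h
        exact ht.2 ⟨ht.1, h⟩
      exact this.mono fun s hs => hs.1.1
    have hmeas := hcont.aestronglyMeasurable (μ := volume)
      (measurableSet_Icc.diff hfin.measurableSet)
    -- The finitely many discontinuities form a null set.
    rw [Measure.restrict_congr_set (sdiff_null_ae_eq_self (hfin.measure_zero volume))] at hmeas
    obtain ⟨K, hK⟩ := isCompact_Icc.exists_bound_of_continuousOn (s := Icc 0 T)
      (f := fun t => M * Real.exp (a * t)) (by fun_prop)
    refine IntegrableOn.of_bound (C := K) (by simp) hmeas ?_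
    refine (ae_restrict_iff' measurableSet_Icc).2 (Eventually.of_forall fun t ht => ?_)
    exact (hb t ht.1).trans ((le_abs_self _).trans (hK t ht))
  rw [locallyIntegrable_iff]
  intro s hs
  obtain ⟨T, hT⟩ := hs.bddAbove
  refine (hneg.union (hpos T)).mono_set fun t ht => ?_
  rcases lt_or_ge t 0 with h | h
  · exact Or.inl h
  · exact Or.inr ⟨h, hT ht⟩

lemma intervalIntegrable_of_locallyIntegrable {u : ℝ → Fin k → ℝ} (hu : LocallyIntegrable u)
    (a b : ℝ) : IntervalIntegrable u volume a b :=
  intervalIntegrable_iff.2 ((hu.integrableOn_isCompact isCompact_uIcc).mono_set uIoc_subset_uIcc)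

lemma SignalEq.symm {f g : ℝ → Fin k → ℝ} (h : SignalEq f g) : SignalEq g f :=
  Filter.EventuallyEq.symm h

lemma SignalEq.trans {f g h : ℝ → Fin k → ℝ} (hfg : SignalEq f g) (hgh : SignalEq g h) :
    SignalEq f h :=
  Filter.EventuallyEq.trans hfg hgh

lemma IsPiecewiseContinuous.add_continuous {u v : ℝ → Fin k → ℝ} (hu : IsPiecewiseContinuous u)
    (hv : Continuous v) : IsPiecewiseContinuous (u + v) := by
  refine ⟨fun T => (hu.1 T).subset ?_, fun t ht => ?_, fun t ht => ?_⟩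
  · rintro t ⟨ht, h⟩
    exact ⟨ht, fun h' => h (h'.add hv.continuousWithinAt)⟩
  · obtain ⟨l, hl⟩ := hu.2.1 t ht
    exact ⟨l + v t, hl.add (hv.continuousAt.mono_left nhdsWithin_le_nhds)⟩
  · obtain ⟨l, hl⟩ := hu.2.2 t ht
    exact ⟨l + v t, hl.add (hv.continuousAt.mono_left nhdsWithin_le_nhds)⟩

lemma exists_norm_le_of_support {v : ℝ → Fin k → ℝ} (hv : Continuous v) {a b : ℝ}
    (hs : ∀ t ∉ Icc a b, v t = 0) : ∃ K, 0 < K ∧ ∀ t, ‖v t‖ ≤ K := by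
  obtain ⟨K, hK⟩ := isCompact_Icc.exists_bound_of_continuousOn (s := Icc a b) hv.continuousOn
  refine ⟨max K 1, by positivity, fun t => ?_⟩
  by_cases ht : t ∈ Icc a b
  · exact (hK t ht).trans (le_max_left _ _)
  · rw [hs t ht, norm_zero]
    positivity

lemma add_mem_inputSignals {u v : ℝ → Fin k → ℝ} (hu : u ∈ InputSignals k) (hv : Continuous v)
    {a b : ℝ} (ha : 0 ≤ a) (hs : ∀ t ∉ Icc a b, v t = 0) : u + v ∈ InputSignals k := by
  obtain ⟨hu0, hpc, M, r, hb⟩ := hu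
  refine ⟨fun t ht => ?_, hpc.add_continuous hv, ?_⟩
  · rw [Pi.add_apply, hu0 t ht, hs t fun h => absurd h.1 (by linarith), add_zero]
  · obtain ⟨K, hK, hvK⟩ := exists_norm_le_of_support hv hs
    refine ⟨|M| + K, |r|, fun t ht => (norm_add_le _ _).trans ?_⟩
    have h1 : Real.exp (r * t) ≤ Real.exp (|r| * t) :=
      Real.exp_le_exp.2 (mul_le_mul_of_nonneg_right (le_abs_self r) ht)
    have h2 : 1 ≤ Real.exp (|r| * t) := Real.one_le_exp (by positivity)
    have h3 : M * Real.exp (r * t) ≤ |M| * Real.exp (|r| * t) :=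
      mul_le_mul (le_abs_self M) h1 (Real.exp_pos _).le (abs_nonneg M)
    have h4 : K ≤ K * Real.exp (|r| * t) := le_mul_of_one_le_right hK.le h2
    rw [add_mul]
    exact add_le_add ((hb t ht).trans h3) ((hvK t).trans h4)

lemma exists_pos_continuousAt {u : ℝ → Fin k → ℝ} (hu : IsPiecewiseContinuous u) :
    ∃ t : ℝ, 0 < t ∧ ContinuousAt u t := by
  obtain ⟨t, ht, h⟩ := (Ioo_infinite (zero_lt_one (α := ℝ))).exists_notMem_finite (hu.1 1)
  refine ⟨t, ht.1, ?_⟩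
  by_contra hc
  exact h ⟨⟨ht.1.le, ht.2.le⟩, fun hw => hc (hw.continuousAt (Ici_mem_nhds ht.1))⟩

/-- One radius serves all times near `t₀`: half of the room in `O` absorbs the variation of `f`, the
other half the perturbation. -/
lemma eventually_add_mem {f : ℝ → Fin k → ℝ} {t₀ : ℝ} (hf : ContinuousAt f t₀)
    {O : Set (Fin k → ℝ)} (hO : IsOpen O) (h : f t₀ ∈ O) :
    ∃ r > 0, ∀ᶠ t in 𝓝 t₀, ∀ v, ‖v‖ < r → f t + v ∈ O := by
  obtain ⟨r, hr, hb⟩ := Metric.isOpen_iff.1 hO _ h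
  refine ⟨r / 2, by positivity, ?_⟩
  filter_upwards [Metric.tendsto_nhds.1 hf (r / 2) (by positivity)] with t ht v hv
  apply hb
  rw [Metric.mem_ball, dist_eq_norm]
  calc ‖f t + v - f t₀‖ = ‖(f t - f t₀) + v‖ := by congr 1; abel
    _ ≤ ‖f t - f t₀‖ + ‖v‖ := norm_add_le _ _
    _ < r / 2 + r / 2 := add_lt_add (by rwa [← dist_eq_norm]) hv
    _ = r := by ring

end signals

/-! ### Null perturbations and the reduction to them -/

namespace LTISystem

variable {n m p : ℕ}

/-- A continuous input `v` that steers `0` to `0` along `z` with zero output, both `v` and `z`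
vanishing outside `[a, b]`. -/
structure IsNullPerturbation (S : LTISystem n m p) (a b : ℝ) (v : ℝ → Fin m → ℝ)
    (z : ℝ → Fin n → ℝ) : Prop where
  continuous_input : Continuous v
  continuous_state : Continuous z
  input_eq_zero : ∀ t ∉ Icc a b, v t = 0
  state_eq_zero : ∀ t ∉ Icc a b, z t = 0
  state_response : S.IsStateResponse 0 v z
  output_eq_zero : ∀ t, S.C *ᵥ z t + S.D *ᵥ v t = 0

variable {S : LTISystem n m p}

lemma IsNullPerturbation.smul {a b : ℝ} {v : ℝ → Fin m → ℝ} {z : ℝ → Fin n → ℝ}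
    (h : S.IsNullPerturbation a b v z) (c : ℝ) : S.IsNullPerturbation a b (c • v) (c • z) where
  continuous_input := h.continuous_input.const_smul c
  continuous_state := h.continuous_state.const_smul c
  input_eq_zero t ht := by simp [h.input_eq_zero t ht]
  state_eq_zero t ht := by simp [h.state_eq_zero t ht]
  state_response t ht := by
    simp only [Pi.smul_apply, Matrix.mulVec_smul, ← smul_add, intervalIntegral.integral_smul]
    have := h.state_response t ht
    rw [zero_add] at this ⊢
    rw [← this]
  output_eq_zero t := by
    simp only [Pi.smul_apply, Matrix.mulVec_smul, ← smul_add, h.output_eq_zero, smul_zero]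

lemma intervalIntegrable_derivative {u : ℝ → Fin m → ℝ} {x : ℝ → Fin n → ℝ}
    (hu : LocallyIntegrable u) (hx : ContinuousOn x (Ici 0)) {t : ℝ} (ht : 0 ≤ t) :
    IntervalIntegrable (fun s => S.A *ᵥ x s + S.B *ᵥ u s) volume 0 t := by
  refine (intervalIntegrable_mulVec _ ?_).add (intervalIntegrable_mulVec _ ?_)
  · exact (hx.mono Icc_subset_Ici_self).intervalIntegrable_of_Icc ht
  · exact intervalIntegrable_of_locallyIntegrable hu 0 t

lemma add_mem_unconstrainedTriples {x₀ : Fin n → ℝ} {u : ℝ → Fin m → ℝ} {x : ℝ → Fin n → ℝ}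
    {y : ℝ → Fin p → ℝ} (h : (u, x, y) ∈ S.unconstrainedTriples x₀) {a b : ℝ} (ha : 0 ≤ a)
    {v : ℝ → Fin m → ℝ} {z : ℝ → Fin n → ℝ} (hvz : S.IsNullPerturbation a b v z) :
    (u + v, x + z, y) ∈ S.unconstrainedTriples x₀ := by
  obtain ⟨⟨hu, hx, hy⟩, hresp, hout⟩ := h
  simp only at hu hx hy hresp hout
  refine ⟨⟨add_mem_inputSignals hu hvz.continuous_input ha hvz.input_eq_zero,
    ContinuousOn.add hx hvz.continuous_state.continuousOn, hy⟩, fun t ht => ?_, ?_⟩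
  · have h1 := intervalIntegrable_derivative (S := S)
      (locallyIntegrable_of_mem_inputSignals hu) hx ht
    have h2 := intervalIntegrable_derivative (S := S)
      hvz.continuous_input.locallyIntegrable hvz.continuous_state.continuousOn ht
    have h3 := hvz.state_response t ht
    have h4 := intervalIntegral.integral_add h1 h2
    simp only [Pi.add_apply, Matrix.mulVec_add]
    rw [hresp t ht, h3, zero_add, add_assoc, ← h4]
    congr 1
    refine intervalIntegral.integral_congr fun s _ => ?_
    abel
  · refine SignalEq.trans hout (Eventually.of_forall fun t => ?_)
    have h5 := hvz.output_eq_zero t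
    simp only [Pi.add_apply, Matrix.mulVec_add]
    rw [add_add_add_comm, h5, add_zero]

lemma not_signalEq_add {u v : ℝ → Fin m → ℝ} {a b : ℝ} (ha : 0 ≤ a) (hv : Continuous v)
    (hs : ∀ t ∉ Icc a b, v t = 0) (hne : v ≠ 0) : ¬ SignalEq u (u + v) := by
  intro h
  apply hne
  rw [← hv.ae_eq_iff_eq volume continuous_zero]
  have h' := (ae_restrict_iff' measurableSet_Ici).1 h
  filter_upwards [h'] with t ht
  by_cases h0 : 0 ≤ t
  · simpa using (ht h0).symm
  · exact hs t fun hab => h0 (ha.trans hab.1)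

/-- The output attached to the input is only almost everywhere equal to `y`; since the output
equation itself holds almost everywhere, `y` may replace it. -/
lemma irPairs_subset_admissiblePairs (S : LTISystem n m p) (U : Set (Fin m → ℝ))
    (X : Set (Fin n → ℝ)) : S.irPairs U X ⊆ S.admissiblePairs U X := by
  rintro ⟨x₀, y⟩ ⟨hm, ⟨u, y'⟩, ⟨x, hx⟩, _, _, _, hy, _⟩
  refine ⟨hm, u, x, ?_⟩
  obtain ⟨⟨⟨h1, h2, _⟩, h4, h5⟩, h6, h7, _⟩ := hx
  exact ⟨⟨⟨h1, h2, hm.2⟩, h4, hy.symm.trans h5⟩, h6, h7, hm.2⟩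

/-- The alternative in `hP` covers both cases of the theorem: either `X` leaves room for a small
change of state, or the state does not change. -/
lemma admissiblePairs_subset_irPairs {U : Set (Fin m → ℝ)} {X : Set (Fin n → ℝ)}
    (hU : IsOpen U)
    (hP : ∀ a b : ℝ, 0 ≤ a → a < b → ∃ v z, S.IsNullPerturbation a b v z ∧ v ≠ 0 ∧
      (IsOpen X ∨ z = 0)) :
    S.admissiblePairs U X ⊆ S.irPairs U X := by
  rintro ⟨x₀, y⟩ ⟨hm, u, x, hq⟩
  have hq' := hq
  obtain ⟨hun, ⟨huU, hu⟩, ⟨hxX, hx⟩, hy⟩ := hq'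
  simp only at huU hu hxX hx hy
  obtain ⟨t₀, ht₀, huc⟩ := exists_pos_continuousAt hu.2.1
  have hxc : ContinuousAt x t₀ := ContinuousOn.continuousAt hx (Ici_mem_nhds ht₀)
  obtain ⟨r, hr, hru⟩ := eventually_add_mem huc hU (huU t₀ ht₀.le)
  obtain ⟨r', hr', hrx⟩ : ∃ r > 0, IsOpen X → ∀ᶠ t in 𝓝 t₀, ∀ v, ‖v‖ < r → x t + v ∈ X := by
    by_cases hX : IsOpen X
    · obtain ⟨r, hr, h⟩ := eventually_add_mem hxc hX (hxX t₀ ht₀.le)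
      exact ⟨r, hr, fun _ => h⟩
    · exact ⟨1, one_pos, fun h => absurd h hX⟩
  have hev : ∀ᶠ t in 𝓝 t₀, 0 < t ∧ (∀ v, ‖v‖ < r → u t + v ∈ U) ∧
      (IsOpen X → ∀ v, ‖v‖ < r' → x t + v ∈ X) := by
    refine (lt_mem_nhds ht₀).and (hru.and ?_)
    by_cases hX : IsOpen X
    · exact (hrx hX).mono fun t ht _ => ht
    · exact Eventually.of_forall fun t h => absurd h hX
  obtain ⟨δ, hδ, hball⟩ := Metric.eventually_nhds_iff_ball.1 hev
  rw [Real.ball_eq_Ioo] at hball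
  have hsub : Icc t₀ (t₀ + δ / 2) ⊆ Ioo (t₀ - δ) (t₀ + δ) := fun t ht =>
    ⟨by linarith [ht.1], by linarith [ht.2]⟩
  obtain ⟨v, z, hvz, hv, hz⟩ := hP t₀ (t₀ + δ / 2) ht₀.le (by linarith)
  obtain ⟨K, hK, hvK⟩ := exists_norm_le_of_support hvz.continuous_input hvz.input_eq_zero
  obtain ⟨L, hL, hzL⟩ := exists_norm_le_of_support hvz.continuous_state hvz.state_eq_zero
  -- The interval is fixed before the bounds `K` and `L` are known; scaling by `c` then makes the
  -- perturbation fit both radii.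
  obtain ⟨c, hc, hcK, hcL⟩ : ∃ c : ℝ, 0 < c ∧ c * K < r ∧ c * L < r' := by
    refine ⟨min (r / (2 * K)) (r' / (2 * L)), by positivity, ?_, ?_⟩
    · calc _ ≤ r / (2 * K) * K := mul_le_mul_of_nonneg_right (min_le_left _ _) hK.le
        _ = r / 2 := by field_simp
        _ < r := by linarith
    · calc _ ≤ r' / (2 * L) * L := mul_le_mul_of_nonneg_right (min_le_right _ _) hL.le
        _ = r' / 2 := by field_simp
        _ < r' := by linarith
  have hcvz := hvz.smul c
  refine ⟨hm, (u, y), ⟨x, hq⟩, (u + c • v, y), ⟨x + c • z, ?_, ?_, ?_, hy⟩, ?_,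
    EventuallyEq.rfl, EventuallyEq.rfl⟩
  · exact add_mem_unconstrainedTriples hun ht₀.le hcvz
  · refine ⟨fun t ht => ?_,
      add_mem_inputSignals hu hcvz.continuous_input ht₀.le hcvz.input_eq_zero⟩
    by_cases h : t ∈ Icc t₀ (t₀ + δ / 2)
    · refine (hball t (hsub h)).2.1 _ ?_
      rw [Pi.smul_apply, norm_smul, Real.norm_of_nonneg hc.le]
      exact (mul_le_mul_of_nonneg_left (hvK t) hc.le).trans_lt hcK
    · simpa [hvz.input_eq_zero t h] using huU t ht
  · refine ⟨fun t ht => ?_, ContinuousOn.add hx hcvz.continuous_state.continuousOn⟩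
    rcases hz with hX | rfl
    · by_cases h : t ∈ Icc t₀ (t₀ + δ / 2)
      · refine (hball t (hsub h)).2.2 hX _ ?_
        rw [Pi.smul_apply, norm_smul, Real.norm_of_nonneg hc.le]
        exact (mul_le_mul_of_nonneg_left (hzL t) hc.le).trans_lt hcL
      · simpa [hvz.state_eq_zero t h] using hxX t ht
    · simpa using hxX t ht
  · exact not_signalEq_add ht₀.le hcvz.continuous_input hcvz.input_eq_zero
      (smul_ne_zero hc.ne' hv)

lemma exists_isNullPerturbation_of_rho_pos (hS : 0 < S.rho) {a b : ℝ} (ha : 0 ≤ a)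
    (hab : a < b) : ∃ v, S.IsNullPerturbation a b v 0 ∧ v ≠ 0 := by
  have : Nontrivial (LinearMap.ker S.B.mulVecLin ⊓ LinearMap.ker S.D.mulVecLin :
    Submodule ℝ (Fin m → ℝ)) := Module.nontrivial_of_finrank_pos hS
  obtain ⟨⟨d, hB, hD⟩, hd⟩ := exists_ne
    (0 : (LinearMap.ker S.B.mulVecLin ⊓ LinearMap.ker S.D.mulVecLin : Submodule ℝ (Fin m → ℝ)))
  have hd0 : d ≠ 0 := fun h => hd (Subtype.ext h)
  have hB : S.B *ᵥ d = 0 := hB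
  have hD : S.D *ᵥ d = 0 := hD
  obtain ⟨f, hf, hfs⟩ := CausalModule.exists_iterated_integrals_supported ha hab 0
  have hfs : ∀ t ∉ Icc a b, CausalModule.eval f t = 0 := by simpa using hfs
  refine ⟨fun t => CausalModule.eval f t • d, ⟨?_, continuous_zero, ?_, fun _ _ => rfl, ?_, ?_⟩, ?_⟩
  · exact (CausalModule.continuous_eval f).smul continuous_const
  · intro t ht
    rw [hfs t ht, zero_smul]
  · intro t _
    simp [Matrix.mulVec_smul, hB]
  · intro t
    simp [Matrix.mulVec_smul, hD]
  · intro h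
    apply hf
    apply CausalModule.eval_injective
    funext t
    have := congrFun h t
    simpa [hd0] using this

/-! ### From unconstrained redundancy to null perturbations -/

open Polynomial

/-- A relation `x = A ∫ x + B w`, `0 = C ∫ x + D w` with `w ≠ 0` between causal signals yields one
between polynomials in the integration operator. -/
lemma exists_polynomial_kernel (S : LTISystem n m p) {x : Fin n → CausalModule}
    {w : Fin m → CausalModule} (hw : w ≠ 0)
    (hx : ∀ j, x j = (X : ℝ[X]) • ∑ k, Polynomial.C (S.A j k) • x k + ∑ i, Polynomial.C (S.B j i) • w i)
    (hy : ∀ q, (X : ℝ[X]) • ∑ k, Polynomial.C (S.C q k) • x k + ∑ i, Polynomial.C (S.D q i) • w i = 0) :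
    ∃ (M : Fin n → ℝ[X]) (N : Fin m → ℝ[X]), N ≠ 0 ∧
      (∀ j, M j = X * ∑ k, Polynomial.C (S.A j k) * M k + ∑ i, Polynomial.C (S.B j i) * N i) ∧
      ∀ q, X * ∑ k, Polynomial.C (S.C q k) * M k + ∑ i, Polynomial.C (S.D q i) * N i = 0 := by
  obtain ⟨i, hi⟩ := Function.ne_iff.1 hw
  -- The functional is chosen not to vanish on a nonzero component of `w`, which gives `N ≠ 0`.
  obtain ⟨l, hl⟩ := exists_functional_ne_zero (R := ℝ[X]) (Sum.elim x w) (Sum.inr i) hi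
  let e (s : Fin n ⊕ Fin m) : Submodule.span ℝ[X] (range (Sum.elim x w)) :=
    ⟨Sum.elim x w s, Submodule.subset_span (mem_range_self s)⟩
  refine ⟨fun k => l (e (Sum.inl k)), fun i => l (e (Sum.inr i)), fun h => hl (congrFun h i),
    fun j => ?_, fun q => ?_⟩
  · have h1 : e (Sum.inl j) = (X : ℝ[X]) • ∑ k, Polynomial.C (S.A j k) • e (Sum.inl k) +
        ∑ i, Polynomial.C (S.B j i) • e (Sum.inr i) := by
      apply Subtype.ext
      simpa [e] using hx j
    refine (congrArg l h1).trans ?_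
    simp only [map_add, map_smul, map_sum, smul_eq_mul]
  · have h1 : (X : ℝ[X]) • ∑ k, Polynomial.C (S.C q k) • e (Sum.inl k) +
        ∑ i, Polynomial.C (S.D q i) • e (Sum.inr i) = 0 := by
      apply Subtype.ext
      simpa [e] using hy q
    have h2 := congrArg l h1
    simpa only [map_add, map_smul, map_sum, smul_eq_mul, map_zero] using h2

lemma eval_sum_C_smul {k l : ℕ} (R : Matrix (Fin l) (Fin k) ℝ) (f : Fin k → CausalModule)
    (j : Fin l) (t : ℝ) :
    CausalModule.eval (∑ i, (Polynomial.C (R j i) : ℝ[X]) • f i) t =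
      (R *ᵥ fun i => CausalModule.eval (f i) t) j := by
  rw [map_sum, Finset.sum_apply]
  simp [Matrix.mulVec, dotProduct]

/-- The relations are those of an integrated input, so the state needs one more `X`: with `v = N f`
and `z = X M f`, multiplying `hM` by `X` gives `z = X (A z + B v)`, the integrated state equation.
-/
lemma exists_isNullPerturbation_of_polynomial_kernel {M : Fin n → ℝ[X]} {N : Fin m → ℝ[X]}
    (hN : N ≠ 0) (hM : ∀ j, M j = X * ∑ k, Polynomial.C (S.A j k) * M k + ∑ i, Polynomial.C (S.B j i) * N i)
    (hy : ∀ q, X * ∑ k, Polynomial.C (S.C q k) * M k + ∑ i, Polynomial.C (S.D q i) * N i = 0)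
    {a b : ℝ} (ha : 0 ≤ a) (hab : a < b) : ∃ v z, S.IsNullPerturbation a b v z ∧ v ≠ 0 := by
  -- `L` bounds the degree of every polynomial applied to `f`, so all the resulting signals vanish
  -- outside `[a, b]`.
  let L := (∑ i, (N i).natDegree) + ∑ j, (X * M j).natDegree
  obtain ⟨f, hf, hfs⟩ := CausalModule.exists_iterated_integrals_supported ha hab L
  let v : Fin m → CausalModule := fun i => N i • f
  let z : Fin n → CausalModule := fun j => (X * M j) • f
  have hz : ∀ j, z j = (X : ℝ[X]) •
      (∑ k, (Polynomial.C (S.A j k) : ℝ[X]) • z k + ∑ i, (Polynomial.C (S.B j i) : ℝ[X]) • v i) := by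
    intro j
    simp only [z, v, smul_smul, ← Finset.sum_smul, ← add_smul]
    congr 2
    conv_lhs => rw [hM j]
    rw [Finset.mul_sum]
    simp only [mul_left_comm X]
  have hout : ∀ q, ∑ k, (Polynomial.C (S.C q k) : ℝ[X]) • z k + ∑ i, (Polynomial.C (S.D q i) : ℝ[X]) • v i = 0 := by
    intro q
    simp only [z, v, smul_smul, ← Finset.sum_smul, ← add_smul]
    have := hy q
    rw [Finset.mul_sum] at this
    simp only [mul_left_comm X] at this
    rw [this, zero_smul]
  have hcv : Continuous fun t i => CausalModule.eval (v i) t :=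
    continuous_pi fun i => CausalModule.continuous_eval (v i)
  have hcz : Continuous fun t j => CausalModule.eval (z j) t :=
    continuous_pi fun j => CausalModule.continuous_eval (z j)
  refine ⟨fun t i => CausalModule.eval (v i) t, fun t j => CausalModule.eval (z j) t,
    ⟨hcv, hcz, ?_, ?_, ?_, ?_⟩, ?_⟩
  · intro t ht
    funext i
    refine CausalModule.eval_smul_eq_zero hfs (le_add_right ?_) ht
    exact Finset.single_le_sum (f := fun i => (N i).natDegree) (fun _ _ => Nat.zero_le _)
      (Finset.mem_univ i)
  · intro t ht
    funext j
    refine CausalModule.eval_smul_eq_zero hfs (le_add_left ?_) ht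
    exact Finset.single_le_sum (f := fun j => (X * M j).natDegree) (fun _ _ => Nat.zero_le _)
      (Finset.mem_univ j)
  · intro t ht
    funext j
    rw [zero_add, integral_pi_apply (intervalIntegrable_derivative hcv.locallyIntegrable
      hcz.continuousOn ht)]
    change CausalModule.eval (z j) t = _
    conv_lhs => rw [hz j, CausalModule.eval_X_smul]
    refine intervalIntegral.integral_congr fun s _ => ?_
    simp only [map_add, Pi.add_apply, eval_sum_C_smul]
  · intro t
    funext q
    rw [Pi.add_apply, ← eval_sum_C_smul, ← eval_sum_C_smul, ← Pi.add_apply, ← map_add, hout,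
      map_zero]
    rfl
  · intro h
    obtain ⟨i, hi⟩ := Function.ne_iff.1 hN
    have h1 : v i = 0 := CausalModule.eval_injective (funext fun t => by
      rw [map_zero]
      exact congrFun (congrFun h t) i)
    exact (smul_ne_zero hi hf) h1

/-- Two distinct inputs with the same output from the same initial state yield a causal relation
`x = A ∫ x + B w`, `0 = C ∫ x + D w` with `w ≠ 0`. -/
lemma IsUnconstrainedIR.exists_causal_relation (hS : S.IsUnconstrainedIR) :
    ∃ (x : Fin n → CausalModule) (w : Fin m → CausalModule), w ≠ 0 ∧
      (∀ j, x j = (X : ℝ[X]) • ∑ k, (Polynomial.C (S.A j k) : ℝ[X]) • x k +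
        ∑ i, (Polynomial.C (S.B j i) : ℝ[X]) • w i) ∧
      ∀ q, (X : ℝ[X]) • ∑ k, (Polynomial.C (S.C q k) : ℝ[X]) • x k + ∑ i, (Polynomial.C (S.D q i) : ℝ[X]) • w i = 0 := by
  obtain ⟨⟨x₀, y⟩, -, ⟨u₁, y₁⟩, ⟨x₁, ⟨⟨hu₁, hx₁, -⟩, hr₁, ho₁⟩, -⟩, ⟨u₂, y₂⟩,
    ⟨x₂, ⟨⟨hu₂, hx₂, -⟩, hr₂, ho₂⟩, -⟩, hne, hy₁, hy₂⟩ := hS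
  simp only at hu₁ hx₁ hr₁ ho₁ hu₂ hx₂ hr₂ ho₂ hne hy₁ hy₂
  have hx₁ : ContinuousOn x₁ (Ici 0) := hx₁
  have hx₂ : ContinuousOn x₂ (Ici 0) := hx₂
  have hl₁ := locallyIntegrable_of_mem_inputSignals hu₁
  have hl₂ := locallyIntegrable_of_mem_inputSignals hu₂
  have hl : LocallyIntegrable (u₁ - u₂) := hl₁.sub hl₂
  have hli : ∀ a b, IntervalIntegrable (u₁ - u₂) volume a b := fun a b => intervalIntegrable_of_locallyIntegrable hl a b
  -- Both states start at `x₀`, so their difference extends continuously by `0` to negative times.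
  -- The input difference may jump, hence it is replaced by its integral.
  let x : ℝ → Fin n → ℝ := fun t => x₁ (max t 0) - x₂ (max t 0)
  let w : ℝ → Fin m → ℝ := fun t => ∫ s in (0 : ℝ)..t, (u₁ - u₂) s
  have hmax : Continuous fun t : ℝ => max t 0 := by fun_prop
  have hxc : Continuous x :=
    (hx₁.comp_continuous hmax fun t => le_max_right t 0).sub
      (hx₂.comp_continuous hmax fun t => le_max_right t 0)
  have hx_of_nonneg : ∀ t, 0 ≤ t → x t = x₁ t - x₂ t := fun t ht => by
    simp only [x, max_eq_left ht]
  have hx0 : ∀ t ≤ 0, x t = 0 := fun t ht => by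
    simp only [x, max_eq_right ht, hr₁ 0 le_rfl, hr₂ 0 le_rfl, intervalIntegral.integral_same,
      sub_self]
  have hwc : Continuous w := intervalIntegral.continuous_primitive hli 0
  have hw0 : ∀ t ≤ 0, w t = 0 := by
    intro t ht
    have h1 : ∀ᵐ s : ℝ, s ∈ uIoc 0 t → (u₁ - u₂) s = 0 := by
      filter_upwards [Measure.ae_ne volume (0 : ℝ)] with s hs hst
      rw [uIoc_of_ge ht] at hst
      have hlt : s < 0 := lt_of_le_of_ne hst.2 hs
      rw [Pi.sub_apply, hu₁.1 s hlt, hu₂.1 s hlt, sub_zero]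
    exact intervalIntegral.integral_zero_ae h1
  have hstate : ∀ t, 0 ≤ t → x t = S.A *ᵥ (∫ s in (0 : ℝ)..t, x s) + S.B *ᵥ w t := by
    intro t ht
    have h1 := intervalIntegral.integral_sub (intervalIntegrable_derivative (S := S) hl₁ hx₁ ht)
      (intervalIntegrable_derivative (S := S) hl₂ hx₂ ht)
    rw [hx_of_nonneg t ht, hr₁ t ht, hr₂ t ht, add_sub_add_left_eq_sub, ← h1,
      ← integral_mulVec _ (hxc.intervalIntegrable 0 t), ← integral_mulVec _ (hli 0 t),
      ← intervalIntegral.integral_add (intervalIntegrable_mulVec _ (hxc.intervalIntegrable 0 t))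
        (intervalIntegrable_mulVec _ (hli 0 t))]
    refine intervalIntegral.integral_congr fun s hs => ?_
    rw [uIcc_of_le ht] at hs
    simp only [hx_of_nonneg s hs.1, Pi.sub_apply, Matrix.mulVec_sub]
    abel
  have houtput : ∀ t, 0 ≤ t → S.C *ᵥ (∫ s in (0 : ℝ)..t, x s) + S.D *ᵥ w t = 0 := by
    intro t ht
    rw [← integral_mulVec _ (hxc.intervalIntegrable 0 t), ← integral_mulVec _ (hli 0 t),
      ← intervalIntegral.integral_add (intervalIntegrable_mulVec _ (hxc.intervalIntegrable 0 t))
        (intervalIntegrable_mulVec _ (hli 0 t))]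
    apply intervalIntegral.integral_zero_ae
    have h1 := (ae_restrict_iff' measurableSet_Ici).1
      (ho₁.symm.trans (hy₁.trans (hy₂.symm.trans ho₂)))
    filter_upwards [h1] with s hs hst
    rw [uIoc_of_le ht] at hst
    have h2 := hs hst.1.le
    rw [hx_of_nonneg s hst.1.le, Pi.sub_apply, Matrix.mulVec_sub, Matrix.mulVec_sub,
      sub_add_sub_comm, h2, sub_self]
  have hwne : w ≠ 0 := by
    intro h
    apply hne
    have h1 : ∀ᵐ t : ℝ, u₁ t = u₂ t := by
      -- Lebesgue differentiation: an integral that is identically zero forces the inputs to agree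
      -- almost everywhere.
      filter_upwards [_root_.LocallyIntegrable.ae_hasDerivAt_integral hl] with t ht
      have h2 := ht 0
      change HasDerivAt w _ t at h2
      rw [h] at h2
      exact sub_eq_zero.1 (h2.unique (hasDerivAt_const t 0))
    exact ae_restrict_of_ae h1
  let xm : Fin n → CausalModule := fun j => CausalModule.mk (fun t => x t j)
    ((continuous_apply j).comp hxc) fun t ht => by rw [hx0 t ht]; rfl
  let wm : Fin m → CausalModule := fun i => CausalModule.mk (fun t => w t i)
    ((continuous_apply i).comp hwc) fun t ht => by rw [hw0 t ht]; rfl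
  have heval : ∀ {k : ℕ} (R : Matrix (Fin k) (Fin n) ℝ) (Q : Matrix (Fin k) (Fin m) ℝ) (j t),
      CausalModule.eval ((X : ℝ[X]) • ∑ i, (Polynomial.C (R j i) : ℝ[X]) • xm i +
        ∑ i, (Polynomial.C (Q j i) : ℝ[X]) • wm i) t =
      (R *ᵥ (∫ s in (0 : ℝ)..t, x s) + Q *ᵥ w t) j := by
    intro k R Q j t
    rw [map_add, Pi.add_apply, Pi.add_apply, eval_sum_C_smul, CausalModule.eval_X_smul,
      ← integral_mulVec _ (hxc.intervalIntegrable 0 t),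
      integral_pi_apply (intervalIntegrable_mulVec _ (hxc.intervalIntegrable 0 t))]
    simp only [eval_sum_C_smul]
    rfl
  refine ⟨xm, wm, ?_, fun j => ?_, fun q => ?_⟩
  · intro h
    apply hwne
    funext t i
    exact congrFun (congrArg CausalModule.eval (congrFun h i)) t
  · apply CausalModule.eval_injective
    funext t
    rcases le_total t 0 with ht | ht
    · rw [CausalModule.eval_of_nonpos _ ht, CausalModule.eval_of_nonpos _ ht]
    · rw [heval, ← hstate t ht]
      rfl
  · apply CausalModule.eval_injective
    funext t
    rcases le_total t 0 with ht | ht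
    · rw [CausalModule.eval_of_nonpos _ ht, CausalModule.eval_of_nonpos _ ht]
    · rw [heval, houtput t ht, map_zero]
      rfl

lemma IsUnconstrainedIR.exists_isNullPerturbation (hS : S.IsUnconstrainedIR) {a b : ℝ}
    (ha : 0 ≤ a) (hab : a < b) : ∃ v z, S.IsNullPerturbation a b v z ∧ v ≠ 0 := by
  obtain ⟨x, w, hw, hx, hy⟩ := IsUnconstrainedIR.exists_causal_relation hS
  obtain ⟨M, N, hN, hM, hy⟩ := exists_polynomial_kernel S hw hx hy
  exact exists_isNullPerturbation_of_polynomial_kernel hN hM hy ha hab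

end LTISystem

end InputRedundancy

theorem corollary1 {n m p : ℕ} (S : InputRedundancy.LTISystem n m p)
    (U : Set (Fin m → ℝ)) (X : Set (Fin n → ℝ))
    (hS : S.IsUnconstrainedIR)
    (h : (0 < S.rho ∧ IsOpen U) ∨ (S.rho = 0 ∧ IsOpen U ∧ IsOpen X)) :
    S.irPairs U X = S.admissiblePairs U X ∧
      ((S.admissiblePairs U X).Nonempty → S.IsUniformlyIR U X) := by
  have heq : S.irPairs U X = S.admissiblePairs U X := by
    refine (S.irPairs_subset_admissiblePairs U X).antisymm ?_
    rcases h with ⟨hrho, hU⟩ | ⟨-, hU, hX⟩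
    · refine InputRedundancy.LTISystem.admissiblePairs_subset_irPairs hU fun a b ha hab => ?_
      obtain ⟨v, hv, hne⟩ :=
        InputRedundancy.LTISystem.exists_isNullPerturbation_of_rho_pos hrho ha hab
      exact ⟨v, 0, hv, hne, Or.inr rfl⟩
    · refine InputRedundancy.LTISystem.admissiblePairs_subset_irPairs hU fun a b ha hab => ?_
      obtain ⟨v, z, hv, hne⟩ := InputRedundancy.LTISystem.IsUnconstrainedIR.exists_isNullPerturbation hS ha hab
      exact ⟨v, z, hv, hne, Or.inl hX⟩
  exact ⟨heq, fun hne => ⟨by rwa [← heq] at hne, heq.symm⟩⟩
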